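/- The class of \emph{finite description linear orders} is the smallest class of linear orders that contains the empty order $\mathbf 0$ and the one-point order $\mathbf 1$ and is closed under order isomorphisms, binary sums $L_0+L_1$, the products $L\cdot\omega$ and $L\cdot\omega^*$ (the ordered sums of copies of $L$ indexed by $\mathbb N$ and by $\mathbb N$ with the reversed order, respectively), and finitary shuffles $\Xi(L_0,\dots,L_{n-1})=\sum_{r\in\mathbb Q}L_{\chi(r)}$ for $n\ge 1$, where $\chi:\mathbb Q\to\{0,\dots,n-1\}$ is a colouring all of whose colour classes are dense in $\mathbb Q$. A (deterministic finite) automaton over $\{0,1\}$ consists of a finite set $Q$ of states, a start state $q_s\in Q$, a set $F\subseteq Q$ of accept states and a partial transition function $\delta:Q\times\{0,1\}\to Q$. It accepts a word if the run from $q_s$ on that word is defined and ends in $F$; its language $L(M)$ is the set of accepted words. The inorder $<_{2}$ on $\{0,1\}^*$ is defined for distinct words $x,y$ as follows: if $w$ is their longest common prefix, $x=wx'$ and $y=wy'$, then $x<_{2}y$ if and only if $x'$ begins with $0$ or $y'$ begins with $1$. The \emph{linguage} of $M$ is the linear order $\mathbf L(M)=(L(M),<_{2})$. \textbf{Theorem.}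 A linear order $L$ is a finite description linear order if and only if it is order-isomorphic to the linguage $\mathbf L(M)$ of some automaton $M$ over $\{0,1\}$. -/

import Mathlib

universe u

/-! ### Finite description linear orders -/

/-- A colouring of the rationals by `n` colours is homogeneous if every colour class is dense. -/
def IsHomogeneousColoring {n : ℕ} (χ : ℚ → Fin n) : Prop :=
  ∀ k : Fin n, Dense (χ ⁻¹' {k})

/-- The smallest class of linear orders containing the empty order and the one-point order and
closed under binary sums, multiplication by `ω` and by `ω*`, finitary shuffles, and order
isomorphisms.

* `L₀ ⊕ₗ L₁` is the sum `L₀ + L₁`;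
* `ℕ ×ₗ L` and `ℕᵒᵈ ×ₗ L` (the first coordinate decides first) are the products `L · ω` and
  `L · ω*`, that is, copies of `L` indexed by `ω` and `ω*`;
* `Σₗ r : ℚ, L (χ r)` is the shuffle of `L 0, …, L (n - 1)`. -/
inductive IsFiniteDescription : (L : Type u) → [LinearOrder L] → Prop
  | zero : IsFiniteDescription PEmpty.{u + 1}
  | one : IsFiniteDescription PUnit.{u + 1}
  | add (L₀ L₁ : Type u) [LinearOrder L₀] [LinearOrder L₁] :
      IsFiniteDescription L₀ → IsFiniteDescription L₁ → IsFiniteDescription (L₀ ⊕ₗ L₁)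
  | mul_omega (L : Type u) [LinearOrder L] :
      IsFiniteDescription L → IsFiniteDescription (ℕ ×ₗ L)
  | mul_omega_star (L : Type u) [LinearOrder L] :
      IsFiniteDescription L → IsFiniteDescription (ℕᵒᵈ ×ₗ L)
  | shuffle (n : ℕ) (L : Fin n → Type u) [∀ k, LinearOrder (L k)] (χ : ℚ → Fin n) :
      IsHomogeneousColoring χ → (∀ k, IsFiniteDescription (L k)) →
      IsFiniteDescription (Σₗ r : ℚ, L (χ r))
  | iso (L L' : Type u) [LinearOrder L] [LinearOrder L'] :
      L ≃o L' → IsFiniteDescription L → IsFiniteDescription L'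

/-! ### Deterministic automata with a partial transition function -/

/-- An automaton over the alphabet `α` with states `Q`, whose transition function is partial
(`none` means undefined). Finiteness of `Q` is required where automata are used. -/
structure PartialDFA (α : Type*) (Q : Type*) where
  /-- the partial transition function -/
  step : Q → α → Option Q
  /-- the start state -/
  start : Q
  /-- the set of accept states -/
  accept : Set Q

namespace PartialDFA

variable {α Q : Type*} (M : PartialDFA α Q)

/-- The state in which the run on a word ends, when the run is defined. -/
def evalFrom (q : Q) : List α → Option Q
  | [] => some q
  | a :: x => (M.step q a).bind fun p => evalFrom p x

/-- The run on `xa` is the run on `x` followed by the transition along `a`. -/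
theorem evalFrom_append_singleton (q : Q) (x : List α) (a : α) :
    M.evalFrom q (x ++ [a]) = (M.evalFrom q x).bind fun p => M.step p a := by
  induction x generalizing q with
  | nil => cases h : M.step q a <;> simp [evalFrom, h]
  | cons b x ih => cases h : M.step q b <;> simp [evalFrom, h, ih]

/-- The set of words on which the run is defined and ends in an accept state. -/
def language : Language α :=
  {x | ∃ q ∈ M.accept, M.evalFrom M.start x = some q}

end PartialDFA

/-! ### The inorder on binary words -/

/-- Words over `{0, 1}`, with `false` for `0` and `true` for `1`. This is a copy of `List Bool`
that carries the inorder instead of the lexicographic order. -/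
def BinWord : Type := List Bool

/-- The inorder relation: `x` precedes `y` if `x ≠ y` and, writing `x = w x'` and `y = w y'` with
`w` the longest common prefix, `x'` begins with `0` or `y'` begins with `1`. -/
def InorderLT (x y : List Bool) : Prop :=
  x ≠ y ∧ ∃ w x' y' : List Bool, x = w ++ x' ∧ y = w ++ y' ∧
    (∀ v : List Bool, v <+: x → v <+: y → v.length ≤ w.length) ∧
    ([false] <+: x' ∨ [true] <+: y')

theorem not_inorderLT_nil_nil : ¬ InorderLT [] [] := fun h => h.1 rfl

theorem inorderLT_nil_cons (b : Bool) (y : List Bool) :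
    InorderLT [] (b :: y) ↔ b = true := by
  constructor
  · rintro ⟨-, w, x', y', hx, hy, -, h⟩
    obtain ⟨rfl, rfl⟩ := List.append_eq_nil_iff.1 hx.symm
    rw [List.nil_append] at hy
    subst hy
    simpa [eq_comm] using h
  · rintro rfl
    exact ⟨by simp, [], [], true :: y, by simp, by simp,
      fun v hv _ => by simp [List.prefix_nil.1 hv], Or.inr (by simp)⟩

theorem inorderLT_cons_nil (a : Bool) (x : List Bool) :
    InorderLT (a :: x) [] ↔ a = false := by
  constructor
  · rintro ⟨-, w, x', y', hx, hy, -, h⟩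
    obtain ⟨rfl, rfl⟩ := List.append_eq_nil_iff.1 hy.symm
    rw [List.nil_append] at hx
    subst hx
    simpa [eq_comm] using h
  · rintro rfl
    exact ⟨by simp, [], false :: x, [], by simp, by simp,
      fun v _ hv => by simp [List.prefix_nil.1 hv], Or.inl (by simp)⟩

theorem inorderLT_cons_cons (a b : Bool) (x y : List Bool) :
    InorderLT (a :: x) (b :: y) ↔ (a = false ∧ b = true) ∨ (a = b ∧ InorderLT x y) := by
  constructor
  · rintro ⟨hne, w, x', y', hx, hy, hmax, h⟩
    cases w with
    | nil =>
      rw [List.nil_append] at hx hy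
      subst hx hy
      by_cases hab : a = b
      · subst hab
        have := hmax [a] (by simp) (by simp)
        simp at this
      · left
        cases a <;> cases b <;> simp_all
    | cons c w =>
      simp only [List.cons_append, List.cons.injEq] at hx hy
      obtain ⟨rfl, rfl⟩ := hx
      obtain ⟨rfl, rfl⟩ := hy
      refine Or.inr ⟨rfl, fun he => hne (by rw [he]), w, x', y', rfl, rfl, fun v h1 h2 => ?_, h⟩
      have := hmax (b :: v) (by simpa using h1) (by simpa using h2)
      simpa using this
  · rintro (⟨rfl, rfl⟩ | ⟨rfl, hne, w, x', y', rfl, rfl, hmax, h⟩)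
    · refine ⟨by simp, [], false :: x, true :: y, rfl, rfl, fun v h1 h2 => ?_, by simp⟩
      cases v with
      | nil => simp
      | cons c v =>
        have e1 := (List.cons_prefix_cons.1 h1).1
        have e2 := (List.cons_prefix_cons.1 h2).1
        simp [e1] at e2
    · refine ⟨by simpa using hne, a :: w, x', y', rfl, rfl, fun v h1 h2 => ?_, h⟩
      cases v with
      | nil => simp
      | cons c v =>
        have := hmax v (List.cons_prefix_cons.1 h1).2 (List.cons_prefix_cons.1 h2).2
        simpa using this

theorem inorderLT_trans : ∀ x y z : List Bool, InorderLT x y → InorderLT y z → InorderLT x z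
  | [], [], _, h, _ => absurd h not_inorderLT_nil_nil
  | _, [], [], _, h => absurd h not_inorderLT_nil_nil
  | [], b :: y, [], h1, h2 => by
    rw [inorderLT_nil_cons] at h1
    rw [inorderLT_cons_nil] at h2
    simp [h1] at h2
  | [], b :: y, c :: z, h1, h2 => by
    rw [inorderLT_nil_cons] at h1 ⊢
    rw [inorderLT_cons_cons] at h2
    grind
  | a :: x, [], c :: z, h1, h2 => by
    rw [inorderLT_cons_nil] at h1
    rw [inorderLT_nil_cons] at h2
    rw [inorderLT_cons_cons]
    exact Or.inl ⟨h1, h2⟩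
  | a :: x, b :: y, [], h1, h2 => by
    rw [inorderLT_cons_nil] at h2 ⊢
    rw [inorderLT_cons_cons] at h1
    grind
  | a :: x, b :: y, c :: z, h1, h2 => by
    rw [inorderLT_cons_cons] at h1 h2 ⊢
    have := inorderLT_trans x y z
    grind

theorem inorderLT_trichotomous :
    ∀ x y : List Bool, InorderLT x y ∨ x = y ∨ InorderLT y x
  | [], [] => by simp
  | [], b :: y => by
    rw [inorderLT_nil_cons, inorderLT_cons_nil]
    cases b <;> simp
  | a :: x, [] => by
    rw [inorderLT_nil_cons, inorderLT_cons_nil]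
    cases a <;> simp
  | a :: x, b :: y => by
    rw [inorderLT_cons_cons, inorderLT_cons_cons]
    have := inorderLT_trichotomous x y
    cases a <;> cases b <;> simp_all

instance BinWord.isStrictTotalOrder :
    IsStrictTotalOrder BinWord (fun x y : BinWord => InorderLT x y) where
  trichotomous x y h1 h2 := ((inorderLT_trichotomous x y).resolve_left h1).resolve_right h2
  irrefl _ h := h.1 rfl
  trans x y z := inorderLT_trans x y z

/-- Binary words are linearly ordered by the inorder: `x < y` is `InorderLT x y`. -/
noncomputable instance BinWord.instLinearOrder : LinearOrder BinWord := by
  classical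
  exact linearOrderOfSTO (fun x y : BinWord => InorderLT x y)

theorem BinWord.lt_iff (x y : BinWord) : x < y ↔ InorderLT x y := Iff.rfl

/-- The linguage of an automaton over `{0, 1}`: its language with the order induced by the
inorder. -/
abbrev PartialDFA.Linguage {Q : Type*} (M : PartialDFA Bool Q) : Type :=
  {x : BinWord // (x : List Bool) ∈ M.language}

/-!
The inorder turns the regular operations into operations on orders. Placing languages below `0` and
below `1` adds their orders, and the languages `1ⁿ0A` and `0ⁿ1A` multiply the order of `A` by `ω`
and by `ω*`. A shuffle arises by hanging copies of `n` languages at the nodes of the complete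
binary tree, the choice depending on the depth modulo `n`: this colours the nodes densely, and a
dense colouring of a countable order is unique up to isomorphism by Cantor's back-and-forth.

Conversely, argue by induction on the number of left quotients of a regular language `T`. Those from
which `T` cannot be reached again have finite descriptions by induction. The words that lead from
`T` back to `T`, with their prefixes, form a tree `P`. The words of `T` to the left of `P` leave its
leftmost path, which is eventually periodic, so they form finitely many finite description orders
followed by a multiple of `ω`; similarly on the right with `ω*`. Every other word of `T` lies in the
same cut of `P` as some node `u` with two children in `P`. What lies in that cut depends only on the
quotient of `T` by `u`, and these quotients colour such nodes densely, so the middle part is a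
shuffle.
-/

/-! ### Dense colourings and Cantor's theorem for coloured orders -/

/-- A dense colouring of a linear order without endpoints: every colour occurs in every open
interval, bounded or not. Unlike `IsHomogeneousColoring` it applies to any linear order and any
type of colours. -/
structure IsDenseColoring {α κ : Type*} [LinearOrder α] (c : α → κ) : Prop where
  exists_between : ∀ (k : κ) (x y : α), x < y → ∃ z, x < z ∧ z < y ∧ c z = k
  exists_lt : ∀ (k : κ) (x : α), ∃ z, z < x ∧ c z = k
  exists_gt : ∀ (k : κ) (x : α), ∃ z, x < z ∧ c z = k

theorem IsHomogeneousColoring.isDenseColoring {n : ℕ} {χ : ℚ → Fin n}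
    (h : IsHomogeneousColoring χ) : IsDenseColoring χ where
  exists_between k _ _ hxy :=
    let ⟨z, hz, hxz, hzy⟩ := (h k).exists_between hxy
    ⟨z, hxz, hzy, hz⟩
  exists_lt k x := let ⟨z, hz, hzx⟩ := (h k).exists_lt x; ⟨z, hzx, hz⟩
  exists_gt k x := let ⟨z, hz, hxz⟩ := (h k).exists_gt x; ⟨z, hxz, hz⟩

namespace IsDenseColoring

variable {α β κ : Type*} [LinearOrder α] [LinearOrder β] {c : α → κ} {d : β → κ}

theorem denselyOrdered (hc : IsDenseColoring c) : DenselyOrdered α :=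
  ⟨fun x y hxy => let ⟨z, hxz, hzy, _⟩ := hc.exists_between (c x) x y hxy; ⟨z, hxz, hzy⟩⟩

theorem noMinOrder (hc : IsDenseColoring c) : NoMinOrder α :=
  ⟨fun x => let ⟨z, hzx, _⟩ := hc.exists_lt (c x) x; ⟨z, hzx⟩⟩

theorem noMaxOrder (hc : IsDenseColoring c) : NoMaxOrder α :=
  ⟨fun x => let ⟨z, hxz, _⟩ := hc.exists_gt (c x) x; ⟨z, hxz⟩⟩

theorem exists_between_finsets [Nonempty α] (hc : IsDenseColoring c) (k : κ) (lo hi : Finset α)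
    (h : ∀ x ∈ lo, ∀ y ∈ hi, x < y) :
    ∃ z, (∀ x ∈ lo, x < z) ∧ (∀ y ∈ hi, z < y) ∧ c z = k := by
  have := hc.denselyOrdered
  have := hc.noMinOrder
  have := hc.noMaxOrder
  obtain ⟨a, ha_lo, ha_hi⟩ := Order.exists_between_finsets lo hi h
  obtain ⟨b, hb_lo, hb_hi⟩ := Order.exists_between_finsets {a} hi (by simpa using ha_hi)
  obtain ⟨z, haz, hzb, hz⟩ := hc.exists_between k a b (hb_lo a (Finset.mem_singleton_self a))
  exact ⟨z, fun x hx => (ha_lo x hx).trans haz, fun y hy => hzb.trans (hb_hi y hy), hz⟩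

/-- Finite partial isomorphisms that preserve colours, the conditions of the back-and-forth
argument. -/
abbrev PartialIso (c : α → κ) (d : β → κ) : Type _ :=
  {f : Order.PartialIso α β // ∀ p ∈ f.val, c p.1 = d p.2}

theorem exists_across [Nonempty β] (hd : IsDenseColoring d) (f : PartialIso c d) (a : α) :
    ∃ b, c a = d b ∧ ∀ p ∈ f.val.val, cmp p.1 a = cmp p.2 b := by
  by_cases h : ∃ b, (a, b) ∈ f.val.val
  · obtain ⟨b, hb⟩ := h
    exact ⟨b, f.prop _ hb, fun p hp => f.val.prop _ hp _ hb⟩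
  obtain ⟨b, hlo, hhi, hb⟩ := hd.exists_between_finsets (c a)
    ({p ∈ f.val.val | p.1 < a}.image Prod.snd) ({p ∈ f.val.val | a < p.1}.image Prod.snd) (by
      simp only [Finset.forall_mem_image, Finset.mem_filter]
      exact fun p hp q hq =>
        (lt_iff_lt_of_cmp_eq_cmp (f.val.prop _ hp.1 _ hq.1)).1 (hp.2.trans hq.2))
  simp only [Finset.forall_mem_image, Finset.mem_filter] at hlo hhi
  refine ⟨b, hb.symm, fun p hp => ?_⟩
  rcases lt_trichotomy p.1 a with hl | rfl | hr
  · rw [hl.cmp_eq_lt, (hlo ⟨hp, hl⟩).cmp_eq_lt]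
  · exact absurd ⟨p.2, hp⟩ h
  · rw [hr.cmp_eq_gt, (hhi ⟨hp, hr⟩).cmp_eq_gt]

theorem exists_extension_left [Nonempty β] (hd : IsDenseColoring d) (f : PartialIso c d) (a : α) :
    ∃ g : PartialIso c d, (∃ b, (a, b) ∈ g.val.val) ∧ f ≤ g := by
  obtain ⟨b, hab, hb⟩ := hd.exists_across f a
  refine ⟨⟨⟨insert (a, b) f.val.val, ?_⟩, ?_⟩, ⟨b, Finset.mem_insert_self _ _⟩,
    Finset.subset_insert _ _⟩
  · simp only [Finset.forall_mem_insert, cmp_self_eq_eq, true_and]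
    refine ⟨fun p hp => ?_, fun p hp => ⟨hb p hp, f.val.prop p hp⟩⟩
    rw [cmp_eq_cmp_symm, hb p hp]
  · exact (Finset.forall_mem_insert _ _ _).2 ⟨hab, f.prop⟩

theorem mem_comm_iff (f : Order.PartialIso α β) (p : β × α) :
    p ∈ f.comm.val ↔ p.swap ∈ f.val := by
  change p ∈ f.val.image (Equiv.prodComm α β) ↔ _
  simp [Prod.swap_eq_iff_eq_swap]

theorem exists_extension_right [Nonempty α] (hc : IsDenseColoring c) (f : PartialIso c d) (b : β) :
    ∃ g : PartialIso c d, (∃ a, (a, b) ∈ g.val.val) ∧ f ≤ g := by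
  obtain ⟨g, ⟨a, ha⟩, hfg⟩ := exists_extension_left hc
    (⟨f.val.comm, fun p hp => (f.prop _ ((mem_comm_iff _ p).1 hp)).symm⟩ : PartialIso d c) b
  exact ⟨⟨g.val.comm, fun p hp => (g.prop _ ((mem_comm_iff _ p).1 hp)).symm⟩,
    ⟨a, (mem_comm_iff _ _).2 ha⟩,
    fun p hp => (mem_comm_iff _ p).2 (hfg ((mem_comm_iff _ p.swap).2 hp))⟩

theorem exists_orderIso [Countable α] [Nonempty α] [Countable β] [Nonempty β]
    (hc : IsDenseColoring c) (hd : IsDenseColoring d) :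
    ∃ e : α ≃o β, ∀ a, d (e a) = c a := by
  cases nonempty_encodable α
  cases nonempty_encodable β
  let cof : α ⊕ β → Order.Cofinal (PartialIso c d) := Sum.elim
    (fun a => ⟨{g | ∃ b, (a, b) ∈ g.val.val}, fun f => exists_extension_left hd f a⟩)
    (fun b => ⟨{g | ∃ a, (a, b) ∈ g.val.val}, fun f => exists_extension_right hc f b⟩)
  let I : Order.Ideal (PartialIso c d) := Order.idealOfCofinals
    ⟨default, fun p hp => absurd hp (Finset.notMem_empty p)⟩ cof
  have forth (a : α) : ∃ b, ∃ f ∈ I, (a, b) ∈ f.val.val := by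
    obtain ⟨f, ⟨b, hb⟩, hf⟩ := Order.cofinal_meets_idealOfCofinals _ cof (Sum.inl a)
    exact ⟨b, f, hf, hb⟩
  have back (b : β) : ∃ a, ∃ f ∈ I, (a, b) ∈ f.val.val := by
    obtain ⟨f, ⟨a, ha⟩, hf⟩ := Order.cofinal_meets_idealOfCofinals _ cof (Sum.inr b)
    exact ⟨a, f, hf, ha⟩
  choose F hF using forth
  choose G hG using back
  refine ⟨OrderIso.ofCmpEqCmp F G fun a b => ?_, fun a => ?_⟩
  · obtain ⟨f, hf, ha⟩ := hF a
    obtain ⟨g, hg, hb⟩ := hG b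
    obtain ⟨m, -, fm, gm⟩ := I.directed _ hf _ hg
    exact m.val.prop (a, _) (fm ha) (_, b) (gm hb)
  · obtain ⟨f, -, ha⟩ := hF a
    exact (f.prop _ ha).symm

end IsDenseColoring

/-! ### Lexicographic sums -/

section LexSums

variable {α β γ : Type*} [LinearOrder α] [LinearOrder β] [LinearOrder γ]

theorem nonempty_sumLex_orderIso {f : α → γ} {g : β → γ} (hf : StrictMono f) (hg : StrictMono g)
    (hfg : ∀ a b, f a < g b) (hs : ∀ z, (∃ a, f a = z) ∨ ∃ b, g b = z) :
    Nonempty (α ⊕ₗ β ≃o γ) := by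
  have hmono : StrictMono fun s : α ⊕ₗ β => Sum.elim f g (ofLex s) := by
    rintro _ _ (h | h | h)
    exacts [hf h, hg h, hfg _ _]
  refine ⟨hmono.orderIsoOfSurjective _ fun z => ?_⟩
  rcases hs z with ⟨a, rfl⟩ | ⟨b, rfl⟩
  exacts [⟨toLex (Sum.inl a), rfl⟩, ⟨toLex (Sum.inr b), rfl⟩]

theorem nonempty_sigmaLex_orderIso {X : α → Type*} [∀ i, LinearOrder (X i)] {g : ∀ i, X i → γ}
    (hg : ∀ i, StrictMono (g i)) (hlt : ∀ i j, i < j → ∀ x y, g i x < g j y)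
    (hs : ∀ z, ∃ i x, g i x = z) : Nonempty ((Σₗ i, X i) ≃o γ) := by
  have hmono : StrictMono fun s : Σₗ i, X i => g (ofLex s).1 (ofLex s).2 := by
    rintro _ _ (⟨_, _, h⟩ | ⟨_, _, h⟩)
    exacts [hlt _ _ h _ _, hg _ h]
  refine ⟨hmono.orderIsoOfSurjective _ fun z => ?_⟩
  obtain ⟨i, x, rfl⟩ := hs z
  exact ⟨toLex ⟨i, x⟩, rfl⟩

theorem nonempty_prodLex_orderIso {f : α → β → γ} (hf : ∀ i, StrictMono (f i))
    (hlt : ∀ i j, i < j → ∀ x y, f i x < f j y) (hs : ∀ z, ∃ i x, f i x = z) :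
    Nonempty (α ×ₗ β ≃o γ) := by
  have hmono : StrictMono fun s : α ×ₗ β => f (ofLex s).1 (ofLex s).2 := by
    intro x y h
    rcases Prod.Lex.lt_iff.1 h with h | ⟨h, h'⟩
    · exact hlt _ _ h _ _
    · simpa only [h] using hf _ h'
  refine ⟨hmono.orderIsoOfSurjective _ fun z => ?_⟩
  obtain ⟨i, x, rfl⟩ := hs z
  exact ⟨toLex (i, x), rfl⟩

theorem nonempty_sigmaLex_congr {X : α → Type*} {Y : β → Type*} [∀ i, LinearOrder (X i)]
    [∀ i, LinearOrder (Y i)] (e : α ≃o β) (h : ∀ i, Nonempty (X i ≃o Y (e i))) :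
    Nonempty ((Σₗ i, X i) ≃o Σₗ i, Y i) := by
  have F i := (h i).some
  refine nonempty_sigmaLex_orderIso (γ := Σₗ i, Y i) (g := fun i x => toLex ⟨e i, F i x⟩)
    (fun i x y hxy => Sigma.Lex.right _ _ ((F i).strictMono hxy))
    (fun i j hij x y => Sigma.Lex.left _ _ (e.strictMono hij)) ?_
  rintro ⟨j, y⟩
  obtain ⟨i, rfl⟩ := e.surjective j
  obtain ⟨x, rfl⟩ := (F i).surjective y
  exact ⟨i, x, rfl⟩

end LexSums

/-! ### Closure properties of finite description orders -/

namespace IsFiniteDescription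

theorem exists_orderIso {L : Type u} [LinearOrder L] (h : IsFiniteDescription L) :
    ∃ (L' : Type*) (_ : LinearOrder L'), IsFiniteDescription L' ∧ Nonempty (L ≃o L') := by
  induction h with
  | zero => exact ⟨PEmpty, inferInstance, zero, ⟨OrderIso.ofIsEmpty _ _⟩⟩
  | one => exact ⟨PUnit, inferInstance, one, ⟨OrderIso.ofUnique _ _⟩⟩
  | add L₀ L₁ _ _ ih₀ ih₁ =>
    obtain ⟨M₀, _, h₀, ⟨e₀⟩⟩ := ih₀
    obtain ⟨M₁, _, h₁, ⟨e₁⟩⟩ := ih₁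
    exact ⟨M₀ ⊕ₗ M₁, inferInstance, add _ _ h₀ h₁, ⟨OrderIso.sumLexCongr e₀ e₁⟩⟩
  | mul_omega L _ ih =>
    obtain ⟨M, _, h, ⟨e⟩⟩ := ih
    exact ⟨ℕ ×ₗ M, inferInstance, mul_omega _ h, ⟨Prod.Lex.prodLexCongr (.refl _) e⟩⟩
  | mul_omega_star L _ ih =>
    obtain ⟨M, _, h, ⟨e⟩⟩ := ih
    exact ⟨ℕᵒᵈ ×ₗ M, inferInstance, mul_omega_star _ h, ⟨Prod.Lex.prodLexCongr (.refl _) e⟩⟩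
  | shuffle n L χ hχ _ ih =>
    choose M _ h e using ih
    exact ⟨Σₗ r : ℚ, M (χ r), inferInstance, shuffle n M χ hχ h,
      nonempty_sigmaLex_congr (OrderIso.refl ℚ) fun r => e (χ r)⟩
  | iso L L' e _ ih =>
    obtain ⟨M, _, h, ⟨e'⟩⟩ := ih
    exact ⟨M, inferInstance, h, ⟨e.symm.trans e'⟩⟩

theorem of_subsingleton (L : Type u) [LinearOrder L] [Subsingleton L] :
    IsFiniteDescription L := by
  cases isEmpty_or_nonempty L
  · exact iso _ _ (OrderIso.ofIsEmpty PEmpty.{u + 1} L) zero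
  · have := uniqueOfSubsingleton (Classical.arbitrary L)
    exact iso _ _ (OrderIso.ofUnique PUnit.{u + 1} L) one

theorem sigmaLex_of_isDenseColoring {D : Type u} {κ : Type*} [LinearOrder D] [Countable D]
    [Finite κ] {c : D → κ} (hc : IsDenseColoring c) {X : κ → Type u} [∀ k, LinearOrder (X k)]
    (hX : ∀ k, IsFiniteDescription (X k)) : IsFiniteDescription (Σₗ d : D, X (c d)) := by
  cases isEmpty_or_nonempty D
  · have : IsEmpty (Σₗ d : D, X (c d)) := ⟨fun x => isEmptyElim (ofLex x).1⟩
    exact of_subsingleton _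
  have := hc.denselyOrdered
  have := hc.noMinOrder
  have := hc.noMaxOrder
  obtain ⟨n, ⟨ε⟩⟩ := Finite.exists_equiv_fin κ
  obtain ⟨e⟩ := Order.iso_of_countable_dense ℚ D
  have hχ : IsHomogeneousColoring fun r => ε (c (e r)) := by
    refine fun k => dense_of_exists_between fun x y hxy => ?_
    obtain ⟨z, hxz, hzy, hz⟩ := hc.exists_between (ε.symm k) (e x) (e y) (e.strictMono hxy)
    exact ⟨e.symm z, by simp [hz], e.lt_symm_apply.2 hxz, e.symm_apply_lt.2 hzy⟩
  obtain ⟨i⟩ : Nonempty ((Σₗ r : ℚ, X (ε.symm (ε (c (e r))))) ≃o Σₗ d : D, X (c d)) :=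
    nonempty_sigmaLex_congr e fun r => by rw [ε.symm_apply_apply]; exact ⟨.refl _⟩
  exact iso _ _ i (shuffle n (fun k => X (ε.symm k)) _ hχ fun k => hX _)

end IsFiniteDescription

/-! ### Comparing binary words -/

/-- The word `x` lies on the side `e` of the word `y` in the inorder, where `false` stands for
left and `true` for right, so that a statement about both ends of an order is made only once. -/
def SideLT (e : Bool) (x y : List Bool) : Prop :=
  if e then InorderLT y x else InorderLT x y

@[simp] theorem sideLT_false (x y : List Bool) : SideLT false x y ↔ InorderLT x y := by
  simp [SideLT]

@[simp] theorem sideLT_true (x y : List Bool) : SideLT true x y ↔ InorderLT y x := by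
  simp [SideLT]

theorem SideLT.trans {e : Bool} {x y z : List Bool} (hxy : SideLT e x y) (hyz : SideLT e y z) :
    SideLT e x z := by
  cases e
  · rw [sideLT_false] at *
    exact inorderLT_trans x y z hxy hyz
  · rw [sideLT_true] at *
    exact inorderLT_trans z y x hyz hxy

theorem sideLT_not {e : Bool} {x y : List Bool} : SideLT (!e) x y ↔ SideLT e y x := by
  cases e <;> simp

theorem sideLT_nil_cons (e b : Bool) (y : List Bool) : SideLT e [] (b :: y) ↔ b = !e := by
  cases e <;> simp [inorderLT_nil_cons, inorderLT_cons_nil]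

theorem sideLT_cons_nil (e a : Bool) (x : List Bool) : SideLT e (a :: x) [] ↔ a = e := by
  cases e <;> simp [inorderLT_nil_cons, inorderLT_cons_nil]

theorem sideLT_cons_cons (e a b : Bool) (x y : List Bool) :
    SideLT e (a :: x) (b :: y) ↔ (a = e ∧ b = !e) ∨ (a = b ∧ SideLT e x y) := by
  cases e <;> simp [inorderLT_cons_cons, and_comm, eq_comm]

theorem sideLT_append_iff (e : Bool) (u x y : List Bool) :
    SideLT e (u ++ x) (u ++ y) ↔ SideLT e x y := by
  induction u with
  | nil => rfl
  | cons a u ih =>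
    rw [List.cons_append, List.cons_append, sideLT_cons_cons, ih]
    cases a <;> cases e <;> simp

theorem inorderLT_append_iff (u x y : List Bool) :
    InorderLT (u ++ x) (u ++ y) ↔ InorderLT x y := by
  simpa using sideLT_append_iff false u x y

theorem sideLT_append_cons (a : Bool) (u t : List Bool) : SideLT a (u ++ a :: t) u := by
  simpa [sideLT_cons_nil] using sideLT_append_iff a u (a :: t) []

theorem SideLT.append_right {e : Bool} {x y : List Bool} (h : SideLT e x y) (hyx : ¬ y <+: x)
    (t : List Bool) : SideLT e x (y ++ t) := by
  induction x generalizing y with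
  | nil =>
    cases y with
    | nil => simp at hyx
    | cons b y => simpa [sideLT_nil_cons] using h
  | cons a x ih =>
    cases y with
    | nil => simp at hyx
    | cons b y =>
      rw [sideLT_cons_cons] at h
      rw [List.cons_append, sideLT_cons_cons]
      rcases h with h | ⟨rfl, h⟩
      · exact Or.inl h
      · exact Or.inr ⟨rfl, ih h fun hyx' => hyx (by simpa using hyx')⟩

theorem not_isPrefix_of_length_lt {α : Type*} {v w : List α} (h : w.length < v.length) :
    ¬ v <+: w :=
  fun hvw => hvw.length_le.not_gt h

theorem InorderLT.append_true_cons_or_append_false_cons :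
    ∀ {x y : List Bool}, InorderLT x y →
      (∀ t, InorderLT (x ++ true :: t) y) ∨ ∀ t, InorderLT x (y ++ false :: t)
  | [], [], h => absurd h not_inorderLT_nil_nil
  | [], b :: y, h => by
    rw [inorderLT_nil_cons] at h
    exact Or.inr fun t => (inorderLT_nil_cons b _).2 h
  | a :: x, [], h => by
    rw [inorderLT_cons_nil] at h
    exact Or.inl fun t => (inorderLT_cons_nil a _).2 h
  | a :: x, b :: y, h => by
    rw [inorderLT_cons_cons] at h
    simp only [List.cons_append, inorderLT_cons_cons]
    rcases h with h | ⟨hab, h⟩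
    · exact Or.inl fun t => Or.inl h
    · exact h.append_true_cons_or_append_false_cons.imp
        (fun h t => Or.inr ⟨hab, h t⟩) fun h t => Or.inr ⟨hab, h t⟩

/-! ### Languages ordered by the inorder -/

/-- A binary language with the inorder; the linguage of an automaton `M` is
`WordOrder M.language`. -/
abbrev WordOrder (S : Language Bool) : Type := {x : BinWord // (x : List Bool) ∈ S}

/-- The words of `S` that do not begin with `v`. -/
def withoutPrefix (S : Language Bool) (v : List Bool) : Language Bool := {w | w ∈ S ∧ ¬ v <+: w}

theorem leftQuotient_withoutPrefix_cons_self (S : Language Bool) (a : Bool) (v : List Bool) :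
    (withoutPrefix S (a :: v)).leftQuotient [a] = withoutPrefix (S.leftQuotient [a]) v :=
  Set.ext fun _ => and_congr_right fun _ => by simp

theorem leftQuotient_withoutPrefix_cons_of_ne {a b : Bool} (h : a ≠ b) (S : Language Bool)
    (v : List Bool) : (withoutPrefix S (b :: v)).leftQuotient [a] = S.leftQuotient [a] :=
  Set.ext fun _ => and_iff_left (by simp [h.symm])

namespace WordOrder

variable {A B S : Language Bool}

theorem nonempty_orderIso_append (u : List Bool) (hS : ∀ w, w ∈ S ↔ ∃ x ∈ A, u ++ x = w) :
    Nonempty (WordOrder A ≃o WordOrder S) := by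
  have hmono : StrictMono fun x : WordOrder A =>
      (⟨(u ++ ·) x.1, (hS _).2 ⟨x.1, x.2, rfl⟩⟩ : WordOrder S) :=
    fun x y h => (inorderLT_append_iff u x.1 y.1).2 h
  refine ⟨hmono.orderIsoOfSurjective _ ?_⟩
  rintro ⟨w, hw⟩
  obtain ⟨x, hx, rfl⟩ := (hS w).1 hw
  exact ⟨⟨x, hx⟩, rfl⟩

theorem nonempty_sumLex_orderIso_union (hS : ∀ w, w ∈ S ↔ w ∈ A ∨ w ∈ B)
    (hlt : ∀ x ∈ A, ∀ y ∈ B, InorderLT x y) :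
    Nonempty (WordOrder A ⊕ₗ WordOrder B ≃o WordOrder S) := by
  refine nonempty_sumLex_orderIso
    (f := fun x : WordOrder A => (⟨x.1, (hS _).2 (Or.inl x.2)⟩ : WordOrder S))
    (g := fun x : WordOrder B => (⟨x.1, (hS _).2 (Or.inr x.2)⟩ : WordOrder S))
    (fun x y h => h) (fun x y h => h) (fun x y => hlt _ x.2 _ y.2) ?_
  rintro ⟨w, hw⟩
  exact ((hS w).1 hw).imp (fun hw => ⟨⟨w, hw⟩, rfl⟩) fun hw => ⟨⟨w, hw⟩, rfl⟩

theorem isDenseColoring {κ : Type*} {c : WordOrder S → κ}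
    (h : ∀ u ∈ S, ∀ (a : Bool) (k : κ), ∃ (t : List Bool) (ht : u ++ a :: t ∈ S), c ⟨_, ht⟩ = k) :
    IsDenseColoring c where
  exists_between k x y hxy := by
    rcases hxy.append_true_cons_or_append_false_cons with hlt | hlt
    · obtain ⟨t, ht, hk⟩ := h x.1 x.2 true k
      exact ⟨_, (sideLT_true _ _).1 (sideLT_append_cons true x.1 t), hlt t, hk⟩
    · obtain ⟨t, ht, hk⟩ := h y.1 y.2 false k
      exact ⟨_, hlt t, (sideLT_false _ _).1 (sideLT_append_cons false y.1 t), hk⟩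
  exists_lt k x :=
    let ⟨t, _, hk⟩ := h x.1 x.2 false k
    ⟨_, (sideLT_false _ _).1 (sideLT_append_cons false x.1 t), hk⟩
  exists_gt k x :=
    let ⟨t, _, hk⟩ := h x.1 x.2 true k
    ⟨_, (sideLT_true _ _).1 (sideLT_append_cons true x.1 t), hk⟩

section Product

variable {v : List Bool}

theorem iterate_append_mem_iff (hS : ∀ w, v ++ w ∈ S ↔ w ∈ S) (n : ℕ) (w : List Bool) :
    (v ++ ·)^[n] w ∈ S ↔ w ∈ S := by
  induction n with
  | zero => rfl
  | succ n ih => rw [Function.iterate_succ_apply', hS, ih]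

theorem sideLT_iterate_append_iff (e : Bool) (v : List Bool) (n : ℕ) (x y : List Bool) :
    SideLT e ((v ++ ·)^[n] x) ((v ++ ·)^[n] y) ↔ SideLT e x y := by
  induction n with
  | zero => rfl
  | succ n ih => simp only [Function.iterate_succ_apply', sideLT_append_iff, ih]

theorem sideLT_iterate_append_of_lt {e : Bool} (hS : ∀ w, v ++ w ∈ S ↔ w ∈ S)
    (hlt : ∀ x ∈ withoutPrefix S v, ∀ y ∈ S, SideLT e x (v ++ y)) {i j : ℕ} (hij : i < j)
    {x y : List Bool} (hx : x ∈ withoutPrefix S v) (hy : y ∈ S) :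
    SideLT e ((v ++ ·)^[i] x) ((v ++ ·)^[j] y) := by
  obtain ⟨k, rfl⟩ := Nat.exists_eq_add_of_lt hij
  rw [add_assoc, Function.iterate_add_apply, sideLT_iterate_append_iff,
    Function.iterate_succ_apply']
  exact hlt x hx _ ((iterate_append_mem_iff hS k y).2 hy)

theorem exists_iterate_append_eq (hv : v ≠ []) (hS : ∀ w, v ++ w ∈ S ↔ w ∈ S)
    (w : List Bool) (hw : w ∈ S) : ∃ n, ∃ x ∈ withoutPrefix S v, (v ++ ·)^[n] x = w := by
  by_cases h : v <+: w
  · obtain ⟨w, rfl⟩ := h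
    have : 0 < v.length := List.length_pos_of_ne_nil hv
    obtain ⟨n, x, hx, rfl⟩ := exists_iterate_append_eq hv hS w ((hS w).1 hw)
    exact ⟨n + 1, x, hx, Function.iterate_succ_apply' _ _ _⟩
  · exact ⟨0, w, ⟨hw, h⟩, rfl⟩
termination_by w.length
decreasing_by grind

theorem nonempty_prodLex_nat_orderIso (hv : v ≠ []) (hS : ∀ w, v ++ w ∈ S ↔ w ∈ S)
    (hlt : ∀ x ∈ withoutPrefix S v, ∀ y ∈ S, SideLT false x (v ++ y)) :
    Nonempty (ℕ ×ₗ WordOrder (withoutPrefix S v) ≃o WordOrder S) := by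
  refine nonempty_prodLex_orderIso (f := fun n (x : WordOrder (withoutPrefix S v)) =>
    (⟨(v ++ ·)^[n] x.1, (iterate_append_mem_iff hS n _).2 x.2.1⟩ : WordOrder S))
    (fun n x y h => ?_) (fun i j hij x y => ?_) ?_
  · exact (sideLT_false _ _).1
      ((sideLT_iterate_append_iff false v n x.1 y.1).2 ((sideLT_false _ _).2 h))
  · exact (sideLT_false _ _).1 (sideLT_iterate_append_of_lt hS hlt hij x.2 y.2.1)
  · rintro ⟨w, hw⟩
    obtain ⟨n, x, hx, rfl⟩ := exists_iterate_append_eq hv hS w hw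
    exact ⟨n, ⟨x, hx⟩, rfl⟩

theorem nonempty_prodLex_natDual_orderIso (hv : v ≠ []) (hS : ∀ w, v ++ w ∈ S ↔ w ∈ S)
    (hlt : ∀ x ∈ withoutPrefix S v, ∀ y ∈ S, SideLT true x (v ++ y)) :
    Nonempty (ℕᵒᵈ ×ₗ WordOrder (withoutPrefix S v) ≃o WordOrder S) := by
  refine nonempty_prodLex_orderIso (f := fun n (x : WordOrder (withoutPrefix S v)) =>
    (⟨(v ++ ·)^[n.ofDual] x.1, (iterate_append_mem_iff hS _ _).2 x.2.1⟩ : WordOrder S))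
    (fun n x y h => ?_) (fun i j hij x y => ?_) ?_
  · exact (sideLT_false _ _).1
      ((sideLT_iterate_append_iff false v _ x.1 y.1).2 ((sideLT_false _ _).2 h))
  · exact (sideLT_true _ _).1 (sideLT_iterate_append_of_lt hS hlt hij y.2 x.2.1)
  · rintro ⟨w, hw⟩
    obtain ⟨n, x, hx, rfl⟩ := exists_iterate_append_eq hv hS w hw
    exact ⟨OrderDual.toDual n, ⟨x, hx⟩, rfl⟩

end Product

end WordOrder

namespace IsFiniteDescription

variable {A B S : Language Bool}

theorem wordOrder_of_subsingleton (hS : ∀ x ∈ S, ∀ y ∈ S, x = y) :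
    IsFiniteDescription (WordOrder S) := by
  have : Subsingleton (WordOrder S) := ⟨fun x y => Subtype.ext (hS x.1 x.2 y.1 y.2)⟩
  exact of_subsingleton _

theorem wordOrder_of_union (hS : ∀ w, w ∈ S ↔ w ∈ A ∨ w ∈ B)
    (hlt : ∀ x ∈ A, ∀ y ∈ B, InorderLT x y) (hA : IsFiniteDescription (WordOrder A))
    (hB : IsFiniteDescription (WordOrder B)) : IsFiniteDescription (WordOrder S) :=
  let ⟨e⟩ := WordOrder.nonempty_sumLex_orderIso_union hS hlt
  iso _ _ e (add _ _ hA hB)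

theorem wordOrder_of_leftQuotient
    (h : ∀ a, IsFiniteDescription (WordOrder (S.leftQuotient [a]))) :
    IsFiniteDescription (WordOrder S) := by
  let part (a : Bool) : Language Bool := {w | ∃ x ∈ S.leftQuotient [a], [a] ++ x = w}
  have hpart (a : Bool) : IsFiniteDescription (WordOrder (part a)) :=
    let ⟨e⟩ := WordOrder.nonempty_orderIso_append [a] (S := part a) fun _ => Iff.rfl
    iso _ _ e (h a)
  let eps : Language Bool := {w | w ∈ S ∧ w = []}
  have heps : IsFiniteDescription (WordOrder eps) :=
    wordOrder_of_subsingleton fun x hx y hy => hx.2.trans hy.2.symm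
  have heps_true : IsFiniteDescription (WordOrder (eps + part true)) :=
    wordOrder_of_union (fun _ => Iff.rfl) (by
      rintro _ ⟨-, rfl⟩ _ ⟨y, -, rfl⟩
      exact (inorderLT_nil_cons true y).2 rfl) heps (hpart true)
  refine wordOrder_of_union (A := part false) (B := eps + part true) (fun w => ?_) ?_
    (hpart false) heps_true
  · change w ∈ S ↔ (∃ x, false :: x ∈ S ∧ false :: x = w) ∨
      (w ∈ S ∧ w = []) ∨ ∃ x, true :: x ∈ S ∧ true :: x = w
    rcases w with _ | ⟨_ | _, w⟩ <;> simp
  · rintro _ ⟨x, -, rfl⟩ _ (⟨-, rfl⟩ | ⟨y, -, rfl⟩)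
    · exact (inorderLT_cons_nil false x).2 rfl
    · exact (inorderLT_cons_cons false true x y).2 (Or.inl ⟨rfl, rfl⟩)

theorem wordOrder_of_append_mem_iff {e : Bool} {v : List Bool} (hv : v ≠ [])
    (hS : ∀ w, v ++ w ∈ S ↔ w ∈ S)
    (hlt : ∀ x ∈ withoutPrefix S v, ∀ y ∈ S, SideLT e x (v ++ y))
    (h : IsFiniteDescription (WordOrder (withoutPrefix S v))) :
    IsFiniteDescription (WordOrder S) := by
  cases e
  · obtain ⟨i⟩ := WordOrder.nonempty_prodLex_nat_orderIso hv hS hlt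
    exact iso _ _ i (mul_omega _ h)
  · obtain ⟨i⟩ := WordOrder.nonempty_prodLex_natDual_orderIso hv hS hlt
    exact iso _ _ i (mul_omega_star _ h)

end IsFiniteDescription

/-! ### Regular languages -/

theorem range_leftQuotient_leftQuotient_subset {α : Type*} (T : Language α) (u : List α) :
    Set.range (T.leftQuotient u).leftQuotient ⊆ Set.range T.leftQuotient := by
  rintro _ ⟨v, rfl⟩
  exact ⟨u ++ v, Language.leftQuotient_append T u v⟩

theorem isRegular_of_leftQuotient {α ι : Type*} [Finite α] [Finite ι] {S : ι → Language α}
    (h : ∀ i a, (S i).leftQuotient [a] ∈ Set.range S ∨ ((S i).leftQuotient [a]).IsRegular)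
    (i : ι) : (S i).IsRegular := by
  let F (p : ι × α) : Set (Language α) :=
    {U | ((S p.1).leftQuotient [p.2]).IsRegular ∧
      U ∈ Set.range ((S p.1).leftQuotient [p.2]).leftQuotient}
  have hF (p : ι × α) : (F p).Finite := by
    by_cases hp : ((S p.1).leftQuotient [p.2]).IsRegular
    · exact hp.finite_range_leftQuotient.subset fun U hU => hU.2
    · exact Set.finite_empty.subset fun U hU => hp hU.1
  have hmem (w : List α) (i : ι) : (S i).leftQuotient w ∈ Set.range S ∪ ⋃ p, F p := by
    induction w generalizing i with
    | nil => exact Or.inl ⟨i, (Language.leftQuotient_nil _).symm⟩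
    | cons a w ih =>
      rw [← List.singleton_append, Language.leftQuotient_append]
      rcases h i a with ⟨j, hj⟩ | hreg
      · exact hj ▸ ih j
      · exact Or.inr (Set.mem_iUnion.2 ⟨(i, a), hreg, w, rfl⟩)
  refine Language.IsRegular.of_finite_range_leftQuotient
    (((Set.finite_range S).union (Set.finite_iUnion hF)).subset ?_)
  rintro _ ⟨w, rfl⟩
  exact hmem w i

namespace PartialDFA

variable {α Q : Type*}

theorem isRegular_language [Finite α] [Finite Q] (M : PartialDFA α Q) :
    M.language.IsRegular := by
  let languageFrom (q : Option Q) : Language α :=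
    {x | ∃ p ∈ M.accept, (q.bind fun q => M.evalFrom q x) = some p}
  refine isRegular_of_leftQuotient (S := languageFrom)
    (fun q a => Or.inl ⟨q.bind fun q => M.step q a, ?_⟩) (some M.start)
  cases q <;> rfl

theorem exists_language_eq {S : Language α} (h : S.IsRegular) :
    ∃ (Q : Type) (_ : Finite Q) (M : PartialDFA α Q), M.language = S := by
  obtain ⟨Q, _, D, rfl⟩ := h
  let M : PartialDFA α Q := ⟨fun q a => some (D.step q a), D.start, D.accept⟩
  have heval (x : List α) (q : Q) : M.evalFrom q x = some (D.evalFrom q x) := by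
    induction x generalizing q with
    | nil => rfl
    | cons a _ ih => exact ih (D.step q a)
  refine ⟨Q, inferInstance, M, Set.ext fun x => ?_⟩
  change (∃ q ∈ M.accept, M.evalFrom M.start x = some q) ↔ D.evalFrom D.start x ∈ D.accept
  simp [heval, M]

end PartialDFA

theorem isRegular_language_zero {α : Type*} [Finite α] : (0 : Language α).IsRegular :=
  isRegular_of_leftQuotient (S := fun _ : Unit => 0) (fun _ _ => Or.inl ⟨(), rfl⟩) ()

theorem isRegular_language_one {α : Type*} [Finite α] : (1 : Language α).IsRegular := by
  refine isRegular_of_leftQuotient (S := fun _ : Unit => 1) (fun _ a => Or.inr ?_) ()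
  have h : (1 : Language α).leftQuotient [a] = 0 :=
    Set.ext fun w => iff_of_false (List.cons_ne_nil a w) (Language.notMem_zero w)
  exact h ▸ isRegular_language_zero

/-! ### Languages for sums, multiples and shuffles -/

/-- The language `0 A₀ ∪ 1 A₁`, which realizes the sum of the orders realized by `A₀` and `A₁`. -/
def branchLanguage (A : Bool → Language Bool) : Language Bool := {w | ∃ a, ∃ x ∈ A a, w = a :: x}

@[simp] theorem cons_mem_branchLanguage {A : Bool → Language Bool} {a : Bool} {w : List Bool} :
    a :: w ∈ branchLanguage A ↔ w ∈ A a := by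
  change (∃ b, ∃ x ∈ A b, a :: w = b :: x) ↔ _
  simp

theorem isRegular_branchLanguage {A : Bool → Language Bool} (h : ∀ a, (A a).IsRegular) :
    (branchLanguage A).IsRegular := by
  refine isRegular_of_leftQuotient (S := fun _ : Unit => branchLanguage A)
    (fun _ a => Or.inr ?_) ()
  convert h a
  ext w
  simp

theorem WordOrder.nonempty_sumLex_orderIso_branchLanguage (A : Bool → Language Bool) :
    Nonempty (WordOrder (A false) ⊕ₗ WordOrder (A true) ≃o WordOrder (branchLanguage A)) := by
  refine nonempty_sumLex_orderIso
    (f := fun x : WordOrder (A false) =>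
      (⟨List.cons false x.1, false, x.1, x.2, rfl⟩ : WordOrder (branchLanguage A)))
    (g := fun x : WordOrder (A true) =>
      (⟨List.cons true x.1, true, x.1, x.2, rfl⟩ : WordOrder (branchLanguage A)))
    (fun x y h => (inorderLT_append_iff [false] x.1 y.1).2 h)
    (fun x y h => (inorderLT_append_iff [true] x.1 y.1).2 h)
    (fun x y => (inorderLT_cons_cons false true x.1 y.1).2 (Or.inl ⟨rfl, rfl⟩)) ?_
  rintro ⟨_, _ | _, x, hx, rfl⟩
  exacts [Or.inl ⟨⟨x, hx⟩, rfl⟩, Or.inr ⟨⟨x, hx⟩, rfl⟩]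

/-- The words `bⁿ a x` with `a ≠ b` and `x ∈ A`. For `b = 1` they realize the product with `ω` of
the order realized by `A`, and for `b = 0` the product with `ω*`. -/
def loopLanguage (b : Bool) (A : Language Bool) : Language Bool :=
  {w | ∃ n, ∃ x ∈ A, w = List.replicate n b ++ (!b) :: x}

section LoopLanguage

variable {b : Bool} {A : Language Bool} {w : List Bool}

theorem mem_loopLanguage :
    w ∈ loopLanguage b A ↔ ∃ n, ∃ x ∈ A, w = List.replicate n b ++ (!b) :: x :=
  Iff.rfl

@[simp] theorem cons_self_mem_loopLanguage : b :: w ∈ loopLanguage b A ↔ w ∈ loopLanguage b A := by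
  simp only [mem_loopLanguage]
  constructor
  · rintro ⟨_ | n, x, hx, h⟩
    · cases b <;> simp at h
    · exact ⟨n, x, hx, List.cons_injective h⟩
  · rintro ⟨n, x, hx, rfl⟩
    exact ⟨n + 1, x, hx, rfl⟩

@[simp] theorem cons_not_mem_loopLanguage : (!b) :: w ∈ loopLanguage b A ↔ w ∈ A := by
  simp only [mem_loopLanguage]
  constructor
  · rintro ⟨_ | n, x, hx, h⟩
    · simpa [List.cons_injective h] using hx
    · cases b <;> simp [List.replicate_succ] at h
  · exact fun hw => ⟨0, w, hw, rfl⟩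

theorem isRegular_loopLanguage (h : A.IsRegular) (b : Bool) : (loopLanguage b A).IsRegular := by
  refine isRegular_of_leftQuotient (S := fun _ : Unit => loopLanguage b A) (fun _ a => ?_) ()
  rcases Bool.eq_or_eq_not a b with rfl | rfl
  · exact Or.inl ⟨(), by ext w; simp⟩
  · refine Or.inr ?_
    convert h
    ext w
    simp

theorem mem_withoutPrefix_loopLanguage :
    w ∈ withoutPrefix (loopLanguage b A) [b] ↔ ∃ x ∈ A, [!b] ++ x = w := by
  change w ∈ loopLanguage b A ∧ ¬ [b] <+: w ↔ _
  constructor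
  · rintro ⟨⟨_ | n, x, hx, rfl⟩, h⟩
    · exact ⟨x, hx, rfl⟩
    · simp [List.replicate_succ] at h
  · rintro ⟨x, hx, rfl⟩
    exact ⟨cons_not_mem_loopLanguage.2 hx, by simp⟩

theorem sideLT_of_mem_withoutPrefix_loopLanguage {x : List Bool}
    (hx : x ∈ withoutPrefix (loopLanguage b A) [b]) (y : List Bool) :
    SideLT (!b) x ([b] ++ y) := by
  obtain ⟨x, -, rfl⟩ := mem_withoutPrefix_loopLanguage.1 hx
  exact (sideLT_cons_cons _ _ _ _ _).2 (Or.inl ⟨rfl, (Bool.not_not b).symm⟩)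

namespace WordOrder

theorem nonempty_prodLex_nat_orderIso_loopLanguage (A : Language Bool) :
    Nonempty (ℕ ×ₗ WordOrder A ≃o WordOrder (loopLanguage true A)) := by
  obtain ⟨e⟩ := nonempty_orderIso_append [!true] fun _ =>
    mem_withoutPrefix_loopLanguage (b := true) (A := A)
  obtain ⟨e'⟩ := nonempty_prodLex_nat_orderIso (List.cons_ne_nil true [])
    (fun _ => cons_self_mem_loopLanguage)
    fun x hx y _ => sideLT_of_mem_withoutPrefix_loopLanguage (A := A) hx y
  exact ⟨(Prod.Lex.prodLexCongr (.refl _) e).trans e'⟩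

theorem nonempty_prodLex_natDual_orderIso_loopLanguage (A : Language Bool) :
    Nonempty (ℕᵒᵈ ×ₗ WordOrder A ≃o WordOrder (loopLanguage false A)) := by
  obtain ⟨e⟩ := nonempty_orderIso_append [!false] fun _ =>
    mem_withoutPrefix_loopLanguage (b := false) (A := A)
  obtain ⟨e'⟩ := nonempty_prodLex_natDual_orderIso (List.cons_ne_nil false [])
    (fun _ => cons_self_mem_loopLanguage)
    fun x hx y _ => sideLT_of_mem_withoutPrefix_loopLanguage (A := A) hx y
  exact ⟨(Prod.Lex.prodLexCongr (.refl _) e).trans e'⟩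

end WordOrder

end LoopLanguage

section ShuffleLanguage

/-- The word obtained from `u` by replacing every letter `1` by `11`. It leaves room for the
word `10` to mark the end of the code. -/
def shuffleCode (u : List Bool) : List Bool :=
  u.flatMap fun a => if a then [true, true] else [false]

@[simp] theorem shuffleCode_nil : shuffleCode [] = [] := rfl

@[simp] theorem shuffleCode_false_cons (u : List Bool) :
    shuffleCode (false :: u) = false :: shuffleCode u := rfl

@[simp] theorem shuffleCode_true_cons (u : List Bool) :
    shuffleCode (true :: u) = true :: true :: shuffleCode u := rfl

theorem shuffleCode_append_inorderLT (x y : List Bool) :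
    ∀ {u v : List Bool}, InorderLT u v →
      InorderLT (shuffleCode u ++ true :: false :: x) (shuffleCode v ++ true :: false :: y)
  | [], [], h => absurd h not_inorderLT_nil_nil
  | [], b :: v, h => by
    rw [inorderLT_nil_cons] at h
    simp [h, inorderLT_cons_cons]
  | a :: u, [], h => by
    rw [inorderLT_cons_nil] at h
    simp [h, inorderLT_cons_cons]
  | a :: u, b :: v, h => by
    rw [inorderLT_cons_cons] at h
    rcases h with ⟨rfl, rfl⟩ | ⟨rfl, h⟩
    · simp [inorderLT_cons_cons]
    · have := shuffleCode_append_inorderLT x y h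
      cases a <;> simpa [inorderLT_cons_cons] using this

variable {κ : Type*} {σ : κ → κ} {A : κ → Language Bool} {k : κ} {w : List Bool}

/-- The language that realizes a shuffle of the orders realized by the languages `A k`: the nodes
`u` of the complete binary tree, in inorder, carry copies of `A (σ^|u| k)`. -/
def shuffleLanguage (σ : κ → κ) (A : κ → Language Bool) (k : κ) : Language Bool :=
  {w | ∃ u, ∃ x ∈ A (σ^[u.length] k), shuffleCode u ++ true :: false :: x = w}

theorem mem_shuffleLanguage : w ∈ shuffleLanguage σ A k ↔
    ∃ u, ∃ x ∈ A (σ^[u.length] k), shuffleCode u ++ true :: false :: x = w :=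
  Iff.rfl

theorem false_cons_mem_shuffleLanguage :
    false :: w ∈ shuffleLanguage σ A k ↔ w ∈ shuffleLanguage σ A (σ k) := by
  simp only [mem_shuffleLanguage]
  constructor
  · rintro ⟨_ | ⟨_ | _, u⟩, x, hx, h⟩
    · simp at h
    · exact ⟨u, x, hx, List.cons_injective h⟩
    · simp at h
  · rintro ⟨u, x, hx, rfl⟩
    exact ⟨false :: u, x, hx, rfl⟩

theorem true_true_cons_mem_shuffleLanguage :
    true :: true :: w ∈ shuffleLanguage σ A k ↔ w ∈ shuffleLanguage σ A (σ k) := by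
  simp only [mem_shuffleLanguage]
  constructor
  · rintro ⟨_ | ⟨_ | _, u⟩, x, hx, h⟩
    · simp at h
    · simp at h
    · exact ⟨u, x, hx, List.cons_injective (List.cons_injective h)⟩
  · rintro ⟨u, x, hx, rfl⟩
    exact ⟨true :: u, x, hx, rfl⟩

theorem true_false_cons_mem_shuffleLanguage :
    true :: false :: w ∈ shuffleLanguage σ A k ↔ w ∈ A k := by
  simp only [mem_shuffleLanguage]
  constructor
  · rintro ⟨_ | ⟨_ | _, u⟩, x, hx, h⟩
    · exact List.cons_injective (List.cons_injective h) ▸ hx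
    · simp at h
    · simp at h
  · exact fun hw => ⟨[], w, hw, rfl⟩

theorem isRegular_shuffleLanguage [Finite κ] (h : ∀ k, (A k).IsRegular) (k : κ) :
    (shuffleLanguage σ A k).IsRegular := by
  let S : κ ⊕ κ → Language Bool := Sum.elim (shuffleLanguage σ A)
    fun k => (shuffleLanguage σ A k).leftQuotient [true]
  refine isRegular_of_leftQuotient (S := S) ?_ (Sum.inl k)
  rintro (k | k) (_ | _)
  · exact Or.inl ⟨Sum.inl (σ k), Set.ext fun w => false_cons_mem_shuffleLanguage.symm⟩
  · exact Or.inl ⟨Sum.inr k, rfl⟩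
  · refine Or.inr ?_
    convert h k using 1
    exact Set.ext fun w => true_false_cons_mem_shuffleLanguage
  · exact Or.inl ⟨Sum.inl (σ k), Set.ext fun w => true_true_cons_mem_shuffleLanguage.symm⟩

namespace WordOrder

theorem isDenseColoring_iterate_length (hσ : ∀ k l, ∃ n, σ^[n] k = l) (k : κ) :
    IsDenseColoring fun u : WordOrder ⊤ => σ^[List.length u.1] k := by
  refine isDenseColoring fun u _ a l => ?_
  obtain ⟨n, hn⟩ := hσ (σ^[u.length + 1] k) l
  refine ⟨List.replicate n a, trivial, ?_⟩
  rw [← hn, ← Function.iterate_add_apply]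
  simp [add_left_comm]

theorem nonempty_sigmaLex_orderIso_shuffleLanguage (σ : κ → κ) (A : κ → Language Bool) (k : κ) :
    Nonempty ((Σₗ u : WordOrder ⊤, WordOrder (A (σ^[List.length u.1] k))) ≃o
      WordOrder (shuffleLanguage σ A k)) := by
  refine nonempty_sigmaLex_orderIso
    (g := fun u x => (⟨(shuffleCode u.1 ++ true :: false :: ·) x.1, u.1, x.1, x.2, rfl⟩ :
      WordOrder (shuffleLanguage σ A k)))
    (fun u x y h => ?_) (fun u v h x y => shuffleCode_append_inorderLT x.1 y.1 h) ?_
  · refine (inorderLT_append_iff (shuffleCode u.1) _ _).2 ?_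
    exact (inorderLT_append_iff [true, false] x.1 y.1).2 h
  · rintro ⟨_, u, x, hx, rfl⟩
    exact ⟨⟨u, trivial⟩, ⟨x, hx⟩, rfl⟩

end WordOrder

end ShuffleLanguage

theorem exists_iterate_add_one_eq {n : ℕ} (k l : Fin (n + 1)) : ∃ m, (· + 1)^[m] k = l := by
  refine ⟨(l - k).val, ?_⟩
  have h : (l - k).val • (1 : Fin (n + 1)) = l - k := by
    have := ZMod.natCast_zmod_val (n := n + 1) (l - k)
    rwa [← nsmul_one] at this
  simp only [add_right_iterate, h, add_sub_cancel]

theorem IsFiniteDescription.exists_isRegular {L : Type u} [LinearOrder L]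
    (h : IsFiniteDescription L) :
    ∃ S : Language Bool, S.IsRegular ∧ Nonempty (L ≃o WordOrder S) := by
  induction h with
  | zero =>
    have : IsEmpty (WordOrder 0) := ⟨fun x => x.2⟩
    exact ⟨0, isRegular_language_zero, ⟨OrderIso.ofIsEmpty _ _⟩⟩
  | one =>
    have : Unique (WordOrder 1) := ⟨⟨⟨[], rfl⟩⟩, fun x => Subtype.ext x.2⟩
    exact ⟨1, isRegular_language_one, ⟨OrderIso.ofUnique _ _⟩⟩
  | add L₀ L₁ _ _ ih₀ ih₁ =>
    obtain ⟨S₀, h₀, ⟨e₀⟩⟩ := ih₀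
    obtain ⟨S₁, h₁, ⟨e₁⟩⟩ := ih₁
    obtain ⟨e⟩ := WordOrder.nonempty_sumLex_orderIso_branchLanguage fun a => cond a S₁ S₀
    exact ⟨_, isRegular_branchLanguage (Bool.forall_bool.2 ⟨h₀, h₁⟩),
      ⟨(OrderIso.sumLexCongr e₀ e₁).trans e⟩⟩
  | mul_omega L _ ih =>
    obtain ⟨S, h, ⟨e⟩⟩ := ih
    obtain ⟨e'⟩ := WordOrder.nonempty_prodLex_nat_orderIso_loopLanguage S
    exact ⟨_, isRegular_loopLanguage h true, ⟨(Prod.Lex.prodLexCongr (.refl _) e).trans e'⟩⟩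
  | mul_omega_star L _ ih =>
    obtain ⟨S, h, ⟨e⟩⟩ := ih
    obtain ⟨e'⟩ := WordOrder.nonempty_prodLex_natDual_orderIso_loopLanguage S
    exact ⟨_, isRegular_loopLanguage h false, ⟨(Prod.Lex.prodLexCongr (.refl _) e).trans e'⟩⟩
  | shuffle n L χ hχ _ ih =>
    obtain _ | n := n
    · exact (χ 0).elim0
    choose A hA e using ih
    have : Nonempty (WordOrder ⊤) := ⟨⟨[], trivial⟩⟩
    have : Countable (WordOrder ⊤) := inferInstanceAs (Countable {x : List Bool // _})
    obtain ⟨i, hi⟩ := hχ.isDenseColoring.exists_orderIso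
      (WordOrder.isDenseColoring_iterate_length exists_iterate_add_one_eq 0)
    obtain ⟨e₁⟩ := nonempty_sigmaLex_congr (X := fun r => L (χ r))
      (Y := fun u : WordOrder ⊤ => WordOrder (A ((· + 1)^[List.length u.1] 0)))
      i fun r => by rw [hi]; exact e (χ r)
    obtain ⟨e₂⟩ := WordOrder.nonempty_sigmaLex_orderIso_shuffleLanguage (· + 1) A 0
    exact ⟨_, isRegular_shuffleLanguage hA 0, ⟨e₁.trans e₂⟩⟩
  | iso L L' e _ ih =>
    obtain ⟨S, h, ⟨e'⟩⟩ := ih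
    exact ⟨S, h, ⟨e.symm.trans e'⟩⟩

/-! ### The strongly connected component of a state -/

/-- The words along which `T` can be left without leaving for good: a state of the minimal
automaton with residual language `T` reaches itself again after each of them. They label the paths
inside its strongly connected component. -/
def loopPrefixes (T : Language Bool) : Language Bool := {u | ∃ v, T.leftQuotient (u ++ v) = T}

/-- Some cycle of the minimal automaton passes through the state with residual language `T`. -/
def IsRecurrent (T : Language Bool) : Prop := ∃ a, [a] ∈ loopPrefixes T

/-- The residual languages outside the strongly connected component of `T` have finite
descriptions. -/
def HasFiniteDescriptionExits (T : Language Bool) : Prop :=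
  ∀ u ∉ loopPrefixes T, IsFiniteDescription (WordOrder (T.leftQuotient u))

section LoopPrefixes

variable {T : Language Bool} {u v : List Bool} {a : Bool}

theorem nil_mem_loopPrefixes (T : Language Bool) : [] ∈ loopPrefixes T := ⟨[], rfl⟩

theorem mem_loopPrefixes_of_leftQuotient_eq (h : T.leftQuotient u = T) : u ∈ loopPrefixes T :=
  ⟨[], by rwa [List.append_nil]⟩

theorem mem_loopPrefixes_of_append (h : u ++ v ∈ loopPrefixes T) : u ∈ loopPrefixes T :=
  let ⟨t, ht⟩ := h
  ⟨v ++ t, by rwa [← List.append_assoc]⟩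

theorem append_mem_loopPrefixes_iff (hu : u ∈ loopPrefixes T) :
    u ++ v ∈ loopPrefixes T ↔ v ∈ loopPrefixes (T.leftQuotient u) := by
  constructor
  · rintro ⟨t, ht⟩
    refine ⟨t ++ u, ?_⟩
    rw [← Language.leftQuotient_append, ← List.append_assoc v, ← List.append_assoc u,
      Language.leftQuotient_append, ← List.append_assoc u, ht]
  · rintro ⟨t, ht⟩
    obtain ⟨s, hs⟩ := hu
    refine ⟨t ++ s, ?_⟩
    rw [List.append_assoc, ← List.append_assoc v, Language.leftQuotient_append,
      Language.leftQuotient_append, ht, ← Language.leftQuotient_append, hs]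

theorem cons_mem_loopPrefixes_iff (ha : [a] ∈ loopPrefixes T) :
    a :: u ∈ loopPrefixes T ↔ u ∈ loopPrefixes (T.leftQuotient [a]) :=
  append_mem_loopPrefixes_iff ha

theorem IsRecurrent.leftQuotient (h : IsRecurrent T) (hu : u ∈ loopPrefixes T) :
    IsRecurrent (T.leftQuotient u) := by
  obtain ⟨_ | ⟨a, v⟩, hv⟩ := hu
  · rw [List.append_nil] at hv
    rwa [hv]
  · refine ⟨a, (append_mem_loopPrefixes_iff ⟨_, hv⟩).1 ?_⟩
    exact mem_loopPrefixes_of_append (v := v) (mem_loopPrefixes_of_leftQuotient_eq (by simpa))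

theorem IsRecurrent.exists_mem_loopPrefixes (h : IsRecurrent T) (n : ℕ) :
    ∃ p ∈ loopPrefixes T, n ≤ p.length := by
  induction n generalizing T with
  | zero => exact ⟨[], nil_mem_loopPrefixes T, le_rfl⟩
  | succ n ih =>
    obtain ⟨a, ha⟩ := h
    obtain ⟨p, hp, hn⟩ := ih (IsRecurrent.leftQuotient ⟨a, ha⟩ ha)
    exact ⟨a :: p, (cons_mem_loopPrefixes_iff ha).2 hp, Nat.succ_le_succ hn⟩

theorem HasFiniteDescriptionExits.leftQuotient (h : HasFiniteDescriptionExits T)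
    (hu : u ∈ loopPrefixes T) : HasFiniteDescriptionExits (T.leftQuotient u) := by
  intro v hv
  rw [← Language.leftQuotient_append]
  exact h _ (mt (append_mem_loopPrefixes_iff hu).1 hv)

end LoopPrefixes

/-! ### The words beyond the component -/

/-- The words of `T` beyond the tree `loopPrefixes T` on the side `e`. Nodes of the tree that are
prefixes of a word are not compared with it, since a word starting with `p` can lie on either side
of `p`. -/
def endPart (e : Bool) (T : Language Bool) : Language Bool :=
  {w | w ∈ T ∧ ∀ p ∈ loopPrefixes T, ¬ p <+: w → SideLT e w p}

section EndPart

variable {T : Language Bool} {e a : Bool} {w : List Bool}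

theorem nil_mem_endPart (h : [] ∈ T) (he : [e] ∉ loopPrefixes T) : [] ∈ endPart e T := by
  refine ⟨h, fun p hp hpw => ?_⟩
  obtain _ | ⟨b, p⟩ := p
  · exact absurd List.nil_prefix hpw
  · refine (sideLT_nil_cons e b p).2 ((Bool.eq_or_eq_not b e).resolve_left ?_)
    rintro rfl
    exact he (mem_loopPrefixes_of_append (v := p) hp)

theorem cons_mem_endPart_iff : a :: w ∈ endPart e T ↔
    (a = e ∨ [e] ∉ loopPrefixes T) ∧ w ∈ T.leftQuotient [a] ∧
      ∀ p, a :: p ∈ loopPrefixes T → ¬ p <+: w → SideLT e w p := by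
  constructor
  · rintro ⟨hw, h⟩
    refine ⟨?_, hw, fun p hp hpw => ?_⟩
    · by_contra! hae
      have := h _ hae.2 (by simpa [eq_comm] using hae.1)
      rcases (sideLT_cons_cons e a e w []).1 this with ⟨-, he⟩ | ⟨rfl, -⟩
      · exact (Bool.not_ne_self e he.symm).elim
      · exact hae.1 rfl
    · exact (sideLT_append_iff e [a] w p).1 (h _ hp (by simpa using hpw))
  · rintro ⟨hae, hw, h⟩
    refine ⟨hw, fun p hp hpw => ?_⟩
    obtain _ | ⟨b, p⟩ := p
    · exact absurd List.nil_prefix hpw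
    rw [sideLT_cons_cons]
    rcases Bool.eq_or_eq_not b a with rfl | rfl
    · exact Or.inr ⟨rfl, h p hp (by simpa using hpw)⟩
    · refine Or.inl ?_
      have ha : a = e := hae.elim id fun he => (Bool.eq_or_eq_not a e).resolve_right ?_
      · exact ⟨ha, ha ▸ rfl⟩
      · rintro rfl
        exact he (mem_loopPrefixes_of_append (v := p) (by simpa using hp))

theorem cons_mem_endPart_of_mem_loopPrefixes (ha : [a] ∈ loopPrefixes T) :
    a :: w ∈ endPart e T ↔
      (a = e ∨ [e] ∉ loopPrefixes T) ∧ w ∈ endPart e (T.leftQuotient [a]) := by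
  simp only [cons_mem_endPart_iff, cons_mem_loopPrefixes_iff ha]
  rfl

theorem cons_mem_endPart_of_notMem_loopPrefixes (ha : [a] ∉ loopPrefixes T) :
    a :: w ∈ endPart e T ↔ (a = e ∨ [e] ∉ loopPrefixes T) ∧ w ∈ T.leftQuotient [a] := by
  rw [cons_mem_endPart_iff, and_iff_left fun p hp => ?_]
  exact absurd (mem_loopPrefixes_of_append (v := p) hp) ha

open Classical in
/-- The first letter of the boundary path of the tree `loopPrefixes T` on the side `e`, or the junk
value `!e` if the tree is just its root. -/
noncomputable def outerLetter (e : Bool) (T : Language Bool) : Bool :=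
  if [e] ∈ loopPrefixes T then e else !e

/-- The initial segment of length `n` of the boundary path of `loopPrefixes T` on the side `e`. -/
noncomputable def outerWord (e : Bool) (T : Language Bool) : ℕ → List Bool
  | 0 => []
  | n + 1 => outerLetter e T :: outerWord e (T.leftQuotient [outerLetter e T]) n

theorem outerLetter_eq_or_notMem (e : Bool) (T : Language Bool) :
    outerLetter e T = e ∨ [e] ∉ loopPrefixes T := by
  unfold outerLetter
  split_ifs with he
  exacts [Or.inl rfl, Or.inr he]

theorem IsRecurrent.outerLetter_mem (h : IsRecurrent T) (e : Bool) :
    [outerLetter e T] ∈ loopPrefixes T := by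
  unfold outerLetter
  split_ifs with he
  · exact he
  · obtain ⟨a, ha⟩ := h
    rcases Bool.eq_or_eq_not a e with rfl | rfl
    exacts [absurd ha he, ha]

theorem IsRecurrent.leftQuotient_endPart_outerLetter (h : IsRecurrent T) (e : Bool) :
    (endPart e T).leftQuotient [outerLetter e T] =
      endPart e (T.leftQuotient [outerLetter e T]) :=
  Set.ext fun _ => (cons_mem_endPart_of_mem_loopPrefixes (h.outerLetter_mem e)).trans
    (and_iff_right (outerLetter_eq_or_notMem e T))

theorem HasFiniteDescriptionExits.wordOrder_leftQuotient_endPart (h : HasFiniteDescriptionExits T)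
    (ha : a ≠ outerLetter e T) :
    IsFiniteDescription (WordOrder ((endPart e T).leftQuotient [a])) := by
  by_cases he : [e] ∈ loopPrefixes T
  · refine .wordOrder_of_subsingleton fun w hw => absurd (cons_mem_endPart_iff.1 hw).1 ?_
    simpa [he, outerLetter] using ha
  · obtain rfl : a = e := by simpa [he, outerLetter] using ha
    have : (endPart a T).leftQuotient [a] = T.leftQuotient [a] := Set.ext fun _ =>
      (cons_mem_endPart_of_notMem_loopPrefixes he).trans (and_iff_right (Or.inl rfl))
    exact this ▸ h _ he

theorem IsRecurrent.leftQuotient_endPart_outerWord (h : IsRecurrent T) (e : Bool) (n : ℕ) :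
    (endPart e T).leftQuotient (outerWord e T n) =
      endPart e (T.leftQuotient (outerWord e T n)) := by
  induction n generalizing T with
  | zero => rfl
  | succ n ih =>
    rw [outerWord, ← List.singleton_append, Language.leftQuotient_append,
      Language.leftQuotient_append, h.leftQuotient_endPart_outerLetter,
      ih (h.leftQuotient (h.outerLetter_mem e))]

theorem leftQuotient_outerWord (e : Bool) (T : Language Bool) (n : ℕ) :
    T.leftQuotient (outerWord e T n) =
      (fun U : Language Bool => U.leftQuotient [outerLetter e U])^[n] T := by
  induction n generalizing T with
  | zero => rfl
  | succ n ih =>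
    rw [Function.iterate_succ_apply, ← ih]
    rfl

theorem IsFiniteDescription.wordOrder_withoutPrefix_outerWord (hT : IsRecurrent T)
    (hexit : HasFiniteDescriptionExits T) (e : Bool) (n : ℕ) :
    IsFiniteDescription (WordOrder (withoutPrefix (endPart e T) (outerWord e T n))) := by
  induction n generalizing T with
  | zero => exact .wordOrder_of_subsingleton fun x hx => absurd List.nil_prefix hx.2
  | succ n ih =>
    refine .wordOrder_of_leftQuotient fun a => ?_
    have hc := hT.outerLetter_mem e
    by_cases ha : a = outerLetter e T
    · subst ha
      rw [outerWord, leftQuotient_withoutPrefix_cons_self, hT.leftQuotient_endPart_outerLetter]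
      exact ih (hT.leftQuotient hc) (hexit.leftQuotient hc)
    · rw [outerWord, leftQuotient_withoutPrefix_cons_of_ne ha]
      exact hexit.wordOrder_leftQuotient_endPart ha

theorem IsFiniteDescription.wordOrder_endPart_of_leftQuotient_eq (hT : IsRecurrent T)
    (hexit : HasFiniteDescriptionExits T) {e : Bool} {n : ℕ}
    (h : T.leftQuotient (outerWord e T (n + 1)) = T) :
    IsFiniteDescription (WordOrder (endPart e T)) := by
  refine wordOrder_of_append_mem_iff (e := e) (v := outerWord e T (n + 1)) (List.cons_ne_nil _ _)
    (fun w => ?_) (fun x hx y _ => ?_) (.wordOrder_withoutPrefix_outerWord hT hexit e (n + 1))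
  · rw [← Language.mem_leftQuotient, hT.leftQuotient_endPart_outerWord, h]
  · exact (hx.1.2 _ (mem_loopPrefixes_of_leftQuotient_eq h) hx.2).append_right hx.2 y

theorem IsFiniteDescription.wordOrder_endPart (hT : IsRecurrent T)
    (hexit : HasFiniteDescriptionExits T) (hfin : (Set.range T.leftQuotient).Finite) (e : Bool) :
    IsFiniteDescription (WordOrder (endPart e T)) := by
  let next (U : Language Bool) := U.leftQuotient [outerLetter e U]
  obtain ⟨m, n, hmn⟩ : ∃ m n, next^[n + 1] (next^[m] T) = next^[m] T := by
    obtain ⟨m, -, n, -, hlt, h⟩ := Set.infinite_univ.exists_lt_map_eq_of_mapsTo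
      (f := fun n => next^[n] T) (t := Set.range T.leftQuotient)
      (fun n _ => ⟨outerWord e T n, leftQuotient_outerWord e T n⟩) hfin
    obtain ⟨k, rfl⟩ := Nat.exists_eq_add_of_lt hlt
    exact ⟨m, k, by rw [← Function.iterate_add_apply, h]; congr 1; omega⟩
  clear hfin
  induction m generalizing T with
  | zero =>
    exact wordOrder_endPart_of_leftQuotient_eq hT hexit
      ((leftQuotient_outerWord e T (n + 1)).trans hmn)
  | succ m ih =>
    have hc := hT.outerLetter_mem e
    refine .wordOrder_of_leftQuotient fun a => ?_
    by_cases ha : a = outerLetter e T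
    · rw [ha, hT.leftQuotient_endPart_outerLetter]
      exact ih (hT.leftQuotient hc) (hexit.leftQuotient hc) hmn
    · exact hexit.wordOrder_leftQuotient_endPart ha

end EndPart

/-! ### The words inside the component -/

/-- The nodes of the tree `loopPrefixes T` both of whose children belong to it. -/
def branchings (T : Language Bool) : Language Bool := {u | ∀ a, u ++ [a] ∈ loopPrefixes T}

/-- For a state `T` both of whose successors lie in its component, the words of `T` that the tree
`loopPrefixes T` does not separate from its root: the empty word, and the words that start with `a`
and lie beyond the subtree below `a` on its inner side `!a`. -/
def core (T : Language Bool) : Language Bool :=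
  {x | x ∈ T ∧ ∀ a y, x = a :: y → y ∈ endPart (!a) (T.leftQuotient [a])}

/-- The words of `T` that occupy the same cut of the tree `loopPrefixes T` as one of its
branchings `u`. -/
def middlePart (T : Language Bool) : Language Bool :=
  {w | ∃ u ∈ branchings T, ∃ x ∈ core (T.leftQuotient u), u ++ x = w}

section MiddlePart

variable {T : Language Bool} {e : Bool} {u v w x p : List Bool}

theorem append_mem_branchings_iff (hu : u ∈ loopPrefixes T) :
    u ++ v ∈ branchings T ↔ v ∈ branchings (T.leftQuotient u) :=
  forall_congr' fun a => by rw [List.append_assoc, append_mem_loopPrefixes_iff hu]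

theorem singleton_mem_loopPrefixes_of_mem_branchings (hu : u ∈ branchings T) (a : Bool) :
    [a] ∈ loopPrefixes (T.leftQuotient u) :=
  (append_mem_loopPrefixes_iff (mem_loopPrefixes_of_append (hu a))).1 (hu a)

theorem cons_mem_endPart_or_middlePart {a : Bool} (ha : [a] ∈ loopPrefixes T) (haw : a :: w ∈ T)
    (hw : (∃ e, w ∈ endPart e (T.leftQuotient [a])) ∨ w ∈ middlePart (T.leftQuotient [a])) :
    (∃ e, a :: w ∈ endPart e T) ∨ a :: w ∈ middlePart T := by
  rcases hw with ⟨e, he⟩ | ⟨u, hu, x, hx, rfl⟩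
  · by_cases h : a = e ∨ [e] ∉ loopPrefixes T
    · exact Or.inl ⟨e, (cons_mem_endPart_of_mem_loopPrefixes ha).2 ⟨h, he⟩⟩
    · push Not at h
      obtain rfl : e = !a := (Bool.eq_or_eq_not e a).resolve_left h.1.symm
      refine Or.inr ⟨[], fun b => ?_, a :: w, ⟨haw, ?_⟩, rfl⟩
      · rcases Bool.eq_or_eq_not b a with rfl | rfl
        exacts [ha, h.2]
      · rintro _ _ ⟨⟩
        exact he
  · exact Or.inr ⟨a :: u, (append_mem_branchings_iff ha).2 hu, x, hx, rfl⟩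

theorem mem_endPart_or_mem_middlePart (hw : w ∈ T) :
    (∃ e, w ∈ endPart e T) ∨ w ∈ middlePart T := by
  induction w generalizing T with
  | nil =>
    by_cases h : ∃ e, [e] ∉ loopPrefixes T
    · obtain ⟨e, he⟩ := h
      exact Or.inl ⟨e, nil_mem_endPart hw he⟩
    · push Not at h
      exact Or.inr ⟨[], h, [], ⟨hw, by simp⟩, rfl⟩
  | cons a w ih =>
    by_cases ha : [a] ∈ loopPrefixes T
    · exact cons_mem_endPart_or_middlePart ha hw (ih hw)
    · exact Or.inl ⟨a, (cons_mem_endPart_of_notMem_loopPrefixes ha).2 ⟨Or.inl rfl, hw⟩⟩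

theorem mem_iff_mem_endPart_or_mem_middlePart :
    w ∈ T ↔ w ∈ endPart false T ∨ w ∈ middlePart T ∨ w ∈ endPart true T := by
  constructor
  · intro hw
    rcases mem_endPart_or_mem_middlePart hw with ⟨_ | _, he⟩ | hm
    exacts [Or.inl he, Or.inr (Or.inr he), Or.inr (Or.inl hm)]
  · rintro (he | ⟨u, -, x, hx, rfl⟩ | he)
    exacts [he.1, hx.1, he.1]

theorem sideLT_append_of_mem_core (hu : u ∈ branchings T) (hx : x ∈ core (T.leftQuotient u))
    (hp : p ∈ loopPrefixes T) (hpx : ¬ p <+: u ++ x) (h : SideLT e u p) :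
    SideLT e (u ++ x) p := by
  induction u generalizing T p with
  | nil =>
    obtain _ | ⟨b, p⟩ := p
    · exact absurd List.nil_prefix hpx
    obtain rfl : b = !e := (sideLT_nil_cons e b p).1 h
    obtain _ | ⟨a, y⟩ := x
    · exact h
    rw [List.nil_append, sideLT_cons_cons]
    rcases Bool.eq_or_eq_not a e with rfl | rfl
    · exact Or.inl ⟨rfl, rfl⟩
    · have hy : y ∈ endPart (!!e) (T.leftQuotient [!e]) := hx.2 _ _ rfl
      rw [Bool.not_not] at hy
      exact Or.inr ⟨rfl, hy.2 p ((cons_mem_loopPrefixes_iff (hu _)).1 hp) (by simpa using hpx)⟩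
  | cons c u ih =>
    obtain _ | ⟨b, p⟩ := p
    · exact absurd List.nil_prefix hpx
    rw [sideLT_cons_cons] at h
    rw [List.cons_append, sideLT_cons_cons]
    have hc : [c] ∈ loopPrefixes T := mem_loopPrefixes_of_append (v := u ++ [c]) (hu c)
    rcases h with h | ⟨rfl, h⟩
    · exact Or.inl h
    exact Or.inr ⟨rfl, ih ((append_mem_branchings_iff hc).1 hu) hx
      ((cons_mem_loopPrefixes_iff hc).1 hp) (by simpa using hpx) h⟩

theorem IsRecurrent.exists_append_cons_mem_loopPrefixes (hT : IsRecurrent T)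
    (hu : u ∈ branchings T) (a : Bool) (n : ℕ) :
    ∃ t, u ++ a :: t ∈ loopPrefixes T ∧ n < (u ++ a :: t).length := by
  obtain ⟨t, ht, hn⟩ := (hT.leftQuotient (hu a)).exists_mem_loopPrefixes n
  refine ⟨t, ?_, ?_⟩
  · simpa using (append_mem_loopPrefixes_iff (hu a)).2 ht
  · simp only [List.length_append, List.length_cons]
    omega

theorem IsRecurrent.inorderLT_endPart_endPart (hT : IsRecurrent T)
    (hv : v ∈ endPart false T) (hw : w ∈ endPart true T) : InorderLT v w := by
  obtain ⟨p, hp, hn⟩ := hT.exists_mem_loopPrefixes (max v.length w.length + 1)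
  have hvp := hv.2 p hp (not_isPrefix_of_length_lt (by omega))
  have hwp := hw.2 p hp (not_isPrefix_of_length_lt (by omega))
  exact inorderLT_trans v p w ((sideLT_false _ _).1 hvp) ((sideLT_true _ _).1 hwp)

theorem IsRecurrent.sideLT_endPart_middlePart (hT : IsRecurrent T)
    (hv : v ∈ endPart e T) (hw : w ∈ middlePart T) : SideLT e v w := by
  obtain ⟨u, hu, x, hx, rfl⟩ := hw
  obtain ⟨t, hp, hn⟩ :=
    hT.exists_append_cons_mem_loopPrefixes hu e (max v.length (u ++ x).length)
  have hvp := hv.2 _ hp (not_isPrefix_of_length_lt (by omega))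
  have hpu := sideLT_append_of_mem_core hu hx hp (not_isPrefix_of_length_lt (by omega))
    (sideLT_not.2 (sideLT_append_cons e u t))
  exact hvp.trans (sideLT_not.1 hpu)

theorem IsRecurrent.exists_mem_loopPrefixes_between (hT : IsRecurrent T) (hu : u ∈ branchings T)
    (hv : v ∈ branchings T) (h : InorderLT u v) (n : ℕ) :
    ∃ p ∈ loopPrefixes T, n < p.length ∧ InorderLT u p ∧ InorderLT p v := by
  rcases h.append_true_cons_or_append_false_cons with hlt | hlt
  · obtain ⟨t, hp, hn⟩ := hT.exists_append_cons_mem_loopPrefixes hu true n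
    exact ⟨_, hp, hn, (sideLT_true _ _).1 (sideLT_append_cons true u t), hlt t⟩
  · obtain ⟨t, hp, hn⟩ := hT.exists_append_cons_mem_loopPrefixes hv false n
    exact ⟨_, hp, hn, hlt t, (sideLT_false _ _).1 (sideLT_append_cons false v t)⟩

theorem IsRecurrent.inorderLT_append_append (hT : IsRecurrent T) {y : List Bool}
    (hu : u ∈ branchings T) (hv : v ∈ branchings T) (h : InorderLT u v)
    (hx : x ∈ core (T.leftQuotient u)) (hy : y ∈ core (T.leftQuotient v)) :
    InorderLT (u ++ x) (v ++ y) := by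
  obtain ⟨p, hp, hn, hup, hpv⟩ :=
    hT.exists_mem_loopPrefixes_between hu hv h (max (u ++ x).length (v ++ y).length)
  have hxp := sideLT_append_of_mem_core hu hx hp (not_isPrefix_of_length_lt (by omega))
    ((sideLT_false _ _).2 hup)
  have hpy := sideLT_append_of_mem_core hv hy hp (not_isPrefix_of_length_lt (by omega))
    ((sideLT_true _ _).2 hpv)
  exact inorderLT_trans _ p _ ((sideLT_false _ _).1 hxp) ((sideLT_true _ _).1 hpy)

theorem IsRecurrent.nonempty_sigmaLex_orderIso_middlePart (hT : IsRecurrent T) :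
    Nonempty ((Σₗ u : WordOrder (branchings T), WordOrder (core (T.leftQuotient u.1))) ≃o
      WordOrder (middlePart T)) := by
  refine nonempty_sigmaLex_orderIso
    (g := fun u x => (⟨(List.append u.1 ·) x.1, u.1, u.2, x.1, x.2, rfl⟩ :
      WordOrder (middlePart T)))
    (fun u x y h => (inorderLT_append_iff u.1 x.1 y.1).2 h)
    (fun u v h x y => hT.inorderLT_append_append u.2 v.2 h x.2 y.2) ?_
  rintro ⟨_, u, hu, x, hx, rfl⟩
  exact ⟨⟨u, hu⟩, ⟨x, hx⟩, rfl⟩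

/-- The states of the minimal automaton that the branchings lead to. -/
def branchingStates (T : Language Bool) : Set (Language Bool) :=
  {U | ∃ u ∈ branchings T, T.leftQuotient u = U}

/-- The colour of a branching is the state that it leads to. -/
def branchingColor (T : Language Bool) (u : WordOrder (branchings T)) : branchingStates T :=
  ⟨T.leftQuotient u.1, u.1, u.2, rfl⟩

theorem isDenseColoring_branchingColor (T : Language Bool) :
    IsDenseColoring (branchingColor T) := by
  refine WordOrder.isDenseColoring fun u hu a => ?_
  rintro ⟨_, v, hv, rfl⟩
  obtain ⟨r, hr⟩ := hu a
  have hrv : u ++ a :: (r ++ v) = (u ++ [a] ++ r) ++ v := by simp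
  refine ⟨r ++ v, ?_, Subtype.ext ?_⟩
  · rwa [hrv, append_mem_branchings_iff (mem_loopPrefixes_of_leftQuotient_eq hr), hr]
  · change T.leftQuotient (u ++ a :: (r ++ v)) = _
    rw [hrv, Language.leftQuotient_append, hr]

end MiddlePart

/-! ### Regular languages realize finite description orders -/

namespace IsFiniteDescription

variable {T : Language Bool}

theorem wordOrder_core (hT : ∀ a, [a] ∈ loopPrefixes T) (hexit : HasFiniteDescriptionExits T)
    (hfin : (Set.range T.leftQuotient).Finite) : IsFiniteDescription (WordOrder (core T)) := by
  refine .wordOrder_of_leftQuotient fun a => ?_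
  have h : (core T).leftQuotient [a] = endPart (!a) (T.leftQuotient [a]) := by
    refine Set.ext fun y => ⟨fun hy => hy.2 a y rfl, fun hy => ⟨hy.1, ?_⟩⟩
    rintro _ _ ⟨⟩
    exact hy
  rw [h]
  exact wordOrder_endPart (IsRecurrent.leftQuotient ⟨a, hT a⟩ (hT a))
    (hexit.leftQuotient (hT a)) (hfin.subset (range_leftQuotient_leftQuotient_subset T [a])) _

theorem wordOrder_middlePart (hT : IsRecurrent T) (hexit : HasFiniteDescriptionExits T)
    (hfin : (Set.range T.leftQuotient).Finite) :
    IsFiniteDescription (WordOrder (middlePart T)) := by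
  have : Countable (WordOrder (branchings T)) := inferInstanceAs (Countable {x : List Bool // _})
  have : Finite (branchingStates T) :=
    hfin.subset fun _ ⟨u, _, hu⟩ => ⟨u, hu⟩
  obtain ⟨e⟩ := hT.nonempty_sigmaLex_orderIso_middlePart
  refine iso _ _ e (sigmaLex_of_isDenseColoring (isDenseColoring_branchingColor T)
    (X := fun U => WordOrder (core U.1)) ?_)
  rintro ⟨_, u, hu, rfl⟩
  exact wordOrder_core (singleton_mem_loopPrefixes_of_mem_branchings hu)
    (hexit.leftQuotient (mem_loopPrefixes_of_append (hu true)))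
    (hfin.subset (range_leftQuotient_leftQuotient_subset T u))

theorem wordOrder_of_isRecurrent (hT : IsRecurrent T) (hexit : HasFiniteDescriptionExits T)
    (hfin : (Set.range T.leftQuotient).Finite) : IsFiniteDescription (WordOrder T) := by
  have hmiddle_true : IsFiniteDescription (WordOrder (middlePart T + endPart true T)) :=
    wordOrder_of_union (fun _ => Iff.rfl)
      (fun x hx y hy => (sideLT_true _ _).1 (hT.sideLT_endPart_middlePart hy hx))
      (wordOrder_middlePart hT hexit hfin) (wordOrder_endPart hT hexit hfin true)
  refine wordOrder_of_union (fun _ => mem_iff_mem_endPart_or_mem_middlePart) ?_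
    (wordOrder_endPart hT hexit hfin false) hmiddle_true
  rintro x hx y (hy | hy)
  · exact (sideLT_false _ _).1 (hT.sideLT_endPart_middlePart hx hy)
  · exact hT.inorderLT_endPart_endPart hx hy

theorem wordOrder_of_finite_range_leftQuotient (hfin : (Set.range T.leftQuotient).Finite) :
    IsFiniteDescription (WordOrder T) := by
  induction hn : (Set.range T.leftQuotient).ncard using Nat.strong_induction_on
    generalizing T with | _ n ih
  have hexit : HasFiniteDescriptionExits T := by
    intro u hu
    have hsub := range_leftQuotient_leftQuotient_subset T u
    refine ih _ (hn ▸ Set.ncard_lt_ncard ⟨hsub, fun hsup => hu ?_⟩ hfin) (hfin.subset hsub) rfl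
    obtain ⟨v, hv⟩ := hsup ⟨[], Language.leftQuotient_nil T⟩
    exact ⟨v, (Language.leftQuotient_append T u v).trans hv⟩
  by_cases hT : IsRecurrent T
  · exact wordOrder_of_isRecurrent hT hexit hfin
  · exact .wordOrder_of_leftQuotient fun a => hexit _ fun ha => hT ⟨a, ha⟩

end IsFiniteDescription

/-- A linear order is a finite description linear order if and only if it is isomorphic to the
linguage of some finite automaton over `{0, 1}`. -/
theorem theorem5 (L : Type u) [LinearOrder L] :
    IsFiniteDescription L ↔
      ∃ (Q : Type) (_ : Finite Q) (M : PartialDFA Bool Q), Nonempty (L ≃o M.Linguage) := by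
  constructor
  · intro h
    obtain ⟨S, hS, e⟩ := h.exists_isRegular
    obtain ⟨Q, hQ, M, rfl⟩ := PartialDFA.exists_language_eq hS
    exact ⟨Q, hQ, M, e⟩
  · rintro ⟨Q, _, M, ⟨e⟩⟩
    have h : IsFiniteDescription M.Linguage :=
      .wordOrder_of_finite_range_leftQuotient M.isRegular_language.finite_range_leftQuotient
    obtain ⟨L', _, hL', ⟨e'⟩⟩ := h.exists_orderIso
    exact .iso _ _ (e.trans e').symm hL'
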